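/- Let $d\ge 0$ be an integer, let $K$ be a nonempty compact subset of $\mathbb R^d$ (with the Euclidean norm), and let $\mathcal P(K)$ be the set of Borel probability measures on $K$. Let $\mathcal H^s$, $\mathcal P^s$ denote the $s$-dimensional Hausdorff and packing measures, and $\dim_{\mathcal H}$, $\dim_{\mathcal P}$ the Hausdorff and packing dimensions. For $\mu\in\mathcal P(K)$ and $x\in K$ put $$\underline{\dim}_{\rm loc}(\mu;x)=\liminf_{r\to 0^+}\frac{\log\mu(B(x,r))}{\log r},\qquad \overline{\dim}_{\rm loc}(\mu;x)=\limsup_{r\to 0^+}\frac{\log\mu(B(x,r))}{\log r}$$ (elements of $[0,+\infty]$, with $\log 0=-\infty$), and $$E^+(\mu;\alpha)=\{x\in K:\ \overline{\dim}_{\rm loc}(\mu;x)=\alpha\},\qquad E(\mu;\alpha)=\{x\in K:\ \underline{\dim}_{\rm loc}(\mu;x)=\overline{\dim}_{\rm loc}(\mu;x)=\alpha\}.$$ (i) Suppose that there is a family $(E_\alpha)_{0<\alpha<\dim_{\mathcal P}(K)}$ of compact subsets of $K$, increasing (that is, $E_\alpha\subset E_\beta$ for $\alpha\le\beta$), such that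 $\dim_{\mathcal P}(E_\alpha)=\alpha$ and $\mathcal P^\alpha(E_\alpha)>0$ for every $\alpha\in(0,\dim_{\mathcal P}(K))$. Then there exists $\mu\in\mathcal P(K)$ such that $\dim_{\mathcal P}\big(E^+(\mu;\alpha)\big)=\alpha$ for every $\alpha\in(0,\dim_{\mathcal P}(K))$. (ii) Suppose that there is an increasing family $(E_\alpha)_{0<\alpha<\dim_{\mathcal P}(K)}$ of compact subsets of $K$ such that $\dim_{\mathcal P}(E_\alpha)=\alpha$ and $\mathcal H^\alpha(E_\alpha)>0$ for every $\alpha\in(0,\dim_{\mathcal P}(K))$. Then there exists $\mu\in\mathcal P(K)$ such that $\dim_{\mathcal H}\big(E(\mu;\alpha)\big)=\dim_{\mathcal P}\big(E(\mu;\alpha)\big)=\alpha$ for every $\alpha\in(0,\dim_{\mathcal P}(K))$. -/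

import Mathlib

open MeasureTheory Filter Topology Set
open scoped ENNReal NNReal MeasureTheory

noncomputable section

section Packing

variable {X : Type*} [PseudoMetricSpace X]

/-- `P`, a set of pairs (centre, radius), is a `δ`-packing of `A`: a countable family of pairwise
disjoint closed balls centred in `A`, of positive radius `r` with `2 * r ≤ δ`. -/
def IsPacking (δ : ℝ) (A : Set X) (P : Set (X × ℝ)) : Prop :=
  P.Countable ∧ (∀ p ∈ P, p.1 ∈ A ∧ 0 < p.2 ∧ 2 * p.2 ≤ δ) ∧
    P.PairwiseDisjoint fun p => Metric.closedBall p.1 p.2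

/-- The supremum of `∑ (2 r_i) ^ s` over all `δ`-packings of `A`. -/
def packingPremeasureAt (s δ : ℝ) (A : Set X) : ℝ≥0∞ :=
  ⨆ (P : Set (X × ℝ)) (_ : IsPacking δ A P), ∑' p : P, ENNReal.ofReal (2 * p.1.2) ^ s

/-- The `s`-dimensional packing premeasure: the (decreasing) limit as `δ → 0`. -/
def packingPremeasure (s : ℝ) (A : Set X) : ℝ≥0∞ :=
  ⨅ (δ : ℝ) (_ : 0 < δ), packingPremeasureAt s δ A

/-- The `s`-dimensional packing (outer) measure `𝒫 ^ s`. -/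
def packingMeasure (s : ℝ) (A : Set X) : ℝ≥0∞ :=
  ⨅ (F : ℕ → Set X) (_ : A ⊆ ⋃ i, F i), ∑' i, packingPremeasure s (F i)

/-- The packing dimension `sup {s ≥ 0 | 𝒫 ^ s (A) = ∞}` (the sup of the empty set is `0`). -/
def packingDim (A : Set X) : ℝ≥0∞ :=
  ⨆ (s : ℝ≥0) (_ : packingMeasure (s : ℝ) A = ∞), (s : ℝ≥0∞)

end Packing

section LocalDimension

variable {X : Type*} [PseudoMetricSpace X] [MeasurableSpace X]

/-- The Borel probability measures on `K`, seen as the probability measures on the ambient space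
which give no mass to the complement of `K`. -/
def probMeasuresOn (K : Set X) : Set (Measure X) :=
  {μ | IsProbabilityMeasure μ ∧ μ Kᶜ = 0}

/-- `log μ(B(x,r)) / log r`, in the extended reals: `log 0 = -∞`, so that for `0 < r < 1` the
quotient is `+∞` when `μ(B(x,r)) = 0`. -/
def localDimRatio (μ : Measure X) (x : X) (r : ℝ) : EReal :=
  ENNReal.log (μ (Metric.closedBall x r)) / ((Real.log r : ℝ) : EReal)

/-- The lower local dimension of `μ` at `x`. -/
def lowerLocalDim (μ : Measure X) (x : X) : EReal :=
  liminf (localDimRatio μ x) (𝓝[>] (0 : ℝ))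

/-- The upper local dimension of `μ` at `x`. -/
def upperLocalDim (μ : Measure X) (x : X) : EReal :=
  limsup (localDimRatio μ x) (𝓝[>] (0 : ℝ))

/-- The points of `K` at which the upper local dimension of `μ` equals `α`. -/
def upperLevelSet (K : Set X) (μ : Measure X) (α : ℝ) : Set X :=
  {x ∈ K | upperLocalDim μ x = (α : EReal)}

/-- The points of `K` at which `μ` has a local dimension, equal to `α`. -/
def levelSet (K : Set X) (μ : Measure X) (α : ℝ) : Set X :=
  {x ∈ K | lowerLocalDim μ x = (α : EReal) ∧ upperLocalDim μ x = (α : EReal)}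

end LocalDimension

/-- `E` is an increasing family of compact subsets of `K`, indexed by the real numbers
`0 < α < dim_P K`, with `dim_P (E α) = α` for every such `α` (the values of `E` at other indices
are irrelevant). -/
def IsDimensionFamily {X : Type*} [PseudoMetricSpace X] (K : Set X) (E : ℝ≥0 → Set X) : Prop :=
  (∀ α : ℝ≥0, 0 < α → (α : ℝ≥0∞) < packingDim K →
    IsCompact (E α) ∧ E α ⊆ K ∧ packingDim (E α) = (α : ℝ≥0∞)) ∧
  ∀ α β : ℝ≥0, 0 < α → α ≤ β → (β : ℝ≥0∞) < packingDim K → E α ⊆ E β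

end

/-! For every finite `μ`, `{upperLocalDim < α}` is `𝒫^α`-null and `{lowerLocalDim < α}` is
`ℋ^α`-null: disjoint balls of mass at least `r ^ t` have `∑ r ^ t ≤ μ univ`, and `t < α` leaves
room. So it suffices to find one `μ` with `upperLocalDim ≤ α` on each `E α`. Discarding a null set
from `E α` then leaves a subset of the level set of positive measure, which gives the lower bounds;
the same ball counts give the upper bounds.

Such a `μ` is built in `exists_measure_upperLocalDim_le_of_packingPremeasure`: if `A` has finite
`s`-packing premeasure and `s < t`, weighting the points of an `r n`-net of `A` by `r n ^ t`, with
`r n` geometric, gives a finite measure with `upperLocalDim ≤ t` on `A`. Adding a multiple of a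
measure can only lower local dimensions, so countably many of these combine into one. Countably many
indices suffice because `E` is increasing: a point of `E α` lies in `E q` for all admissible `q >
α`. -/

theorem tendsto_ofReal_rpow_nhdsGT_zero {a : ℝ} (ha : 0 < a) :
    Tendsto (fun r : ℝ => ENNReal.ofReal r ^ a) (𝓝[>] 0) (𝓝 0) := by
  have hc : Continuous fun r : ℝ => ENNReal.ofReal r ^ a :=
    ENNReal.continuous_rpow_const.comp ENNReal.continuous_ofReal
  simpa [ENNReal.zero_rpow_of_pos ha] using
    (hc.tendsto 0).mono_left (nhdsWithin_le_nhds (s := Ioi 0))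

/-! ### Packing measures and packing dimension. -/

section PackingLemmas

variable {X : Type*} [PseudoMetricSpace X]

theorem packingPremeasure_empty (s : ℝ) : packingPremeasure s (∅ : Set X) = 0 := by
  refine le_antisymm (iInf₂_le_of_le 1 one_pos (iSup₂_le fun P hP => ?_)) zero_le
  have : P = ∅ := eq_empty_of_forall_notMem fun p hp => (hP.2.1 p hp).1
  subst this
  simp

/-- The packing measure as a Mathlib outer measure. -/
noncomputable def packingOuterMeasure (X : Type*) [PseudoMetricSpace X] (s : ℝ) : OuterMeasure X :=
  OuterMeasure.ofFunction (packingPremeasure s) (packingPremeasure_empty s)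

theorem packingOuterMeasure_apply (s : ℝ) (A : Set X) :
    packingOuterMeasure X s A = packingMeasure s A :=
  OuterMeasure.ofFunction_apply _ _ _

theorem packingMeasure_mono (s : ℝ) {A B : Set X} (h : A ⊆ B) :
    packingMeasure s A ≤ packingMeasure s B := by
  simpa only [packingOuterMeasure_apply] using measure_mono (μ := packingOuterMeasure X s) h

theorem packingMeasure_iUnion_null {ι : Type*} [Countable ι] {s : ℝ} {A : ι → Set X}
    (h : ∀ i, packingMeasure s (A i) = 0) : packingMeasure s (⋃ i, A i) = 0 := by
  simp only [← packingOuterMeasure_apply] at h ⊢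
  exact measure_iUnion_null h

theorem packingMeasure_ne_zero_of_diff_null {s : ℝ} {A B : Set X} (hA : packingMeasure s A ≠ 0)
    (h : packingMeasure s (A \ B) = 0) : packingMeasure s B ≠ 0 := by
  simp only [← packingOuterMeasure_apply] at *
  intro hB
  refine hA (measure_mono_null (t := A \ B ∪ B) (by simp) (measure_union_null h hB))

theorem packingMeasure_le_packingPremeasure (s : ℝ) (A : Set X) :
    packingMeasure s A ≤ packingPremeasure s A := by
  rw [← packingOuterMeasure_apply]
  exact OuterMeasure.ofFunction_le A

theorem exists_packingPremeasureAt_lt_top {s : ℝ} {A : Set X} (h : packingPremeasure s A ≠ ∞) :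
    ∃ δ, 0 < δ ∧ packingPremeasureAt s δ A < ∞ := by
  have h := lt_top_iff_ne_top.2 h
  simp only [packingPremeasure, iInf_lt_iff] at h
  obtain ⟨δ, hδ, h⟩ := h
  exact ⟨δ, hδ, h⟩

theorem exists_cover_packingPremeasure_ne_top {s : ℝ} {A : Set X} (h : packingMeasure s A ≠ ∞) :
    ∃ F : ℕ → Set X, A ⊆ ⋃ i, F i ∧ ∀ i, packingPremeasure s (F i) ≠ ∞ := by
  have h := lt_top_iff_ne_top.2 h
  simp only [packingMeasure, iInf_lt_iff] at h
  obtain ⟨F, hF, h⟩ := h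
  exact ⟨F, hF, fun i => ENNReal.ne_top_of_tsum_ne_top h.ne i⟩

theorem packingPremeasureAt_mono {s δ : ℝ} {A B : Set X} (h : A ⊆ B) :
    packingPremeasureAt s δ A ≤ packingPremeasureAt s δ B :=
  iSup₂_le fun P hP => le_iSup₂_of_le P
    ⟨hP.1, fun p hp => ⟨h (hP.2.1 p hp).1, (hP.2.1 p hp).2⟩, hP.2.2⟩ le_rfl

theorem packingPremeasureAt_le_mul {s t δ δ' : ℝ} (hst : s ≤ t) (hδ : δ ≤ δ') (A : Set X) :
    packingPremeasureAt t δ A ≤ ENNReal.ofReal δ ^ (t - s) * packingPremeasureAt s δ' A := by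
  refine iSup₂_le fun P hP => ?_
  refine le_trans ?_ (mul_le_mul_right (le_iSup₂_of_le P ⟨hP.1, fun p hp => ⟨(hP.2.1 p hp).1,
    (hP.2.1 p hp).2.1, (hP.2.1 p hp).2.2.trans hδ⟩, hP.2.2⟩ le_rfl) _)
  rw [← ENNReal.tsum_mul_left]
  refine ENNReal.tsum_le_tsum fun p => ?_
  obtain ⟨-, h0, h1⟩ := hP.2.1 p.1 p.2
  have hpos : 0 < 2 * p.1.2 := by positivity
  calc ENNReal.ofReal (2 * p.1.2) ^ t
      = ENNReal.ofReal (2 * p.1.2) ^ (t - s) * ENNReal.ofReal (2 * p.1.2) ^ s := by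
        rw [← ENNReal.rpow_add _ _ (by simpa using h0) ENNReal.ofReal_ne_top, sub_add_cancel]
    _ ≤ _ := by gcongr

theorem packingPremeasure_eq_zero_of_lt {s t : ℝ} (hst : s < t) {A : Set X}
    (h : packingPremeasure s A ≠ ∞) : packingPremeasure t A = 0 := by
  obtain ⟨δ₀, hδ₀, hM⟩ := exists_packingPremeasureAt_lt_top h
  have hst' : 0 < t - s := sub_pos.2 hst
  have key : Tendsto (fun δ : ℝ => ENNReal.ofReal δ ^ (t - s) * packingPremeasureAt s δ₀ A)
      (𝓝[>] 0) (𝓝 0) := by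
    simpa using ENNReal.Tendsto.mul_const (tendsto_ofReal_rpow_nhdsGT_zero hst') (Or.inr hM.ne)
  refine le_antisymm (ge_of_tendsto key ?_) zero_le
  filter_upwards [Ioc_mem_nhdsGT hδ₀] with δ hδ
  exact (iInf₂_le δ hδ.1).trans (packingPremeasureAt_le_mul hst.le hδ.2 A)

theorem packingMeasure_eq_zero_of_lt {s t : ℝ} (hst : s < t) {A : Set X}
    (h : packingMeasure s A ≠ ∞) : packingMeasure t A = 0 := by
  obtain ⟨F, hF, hF'⟩ := exists_cover_packingPremeasure_ne_top h
  refine le_antisymm ((packingMeasure_mono t hF).trans (packingMeasure_iUnion_null fun i => ?_).le)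
    zero_le
  exact le_antisymm ((packingMeasure_le_packingPremeasure _ _).trans
    (packingPremeasure_eq_zero_of_lt hst (hF' i)).le) zero_le

theorem packingMeasure_ne_top_of_packingDim_lt {A : Set X} {s : ℝ≥0}
    (h : packingDim A < (s : ℝ≥0∞)) : packingMeasure (s : ℝ) A ≠ ∞ := fun hs =>
  h.not_ge (le_iSup₂_of_le (f := fun (s : ℝ≥0) (_ : packingMeasure (s : ℝ) A = ∞) => (s : ℝ≥0∞))
    s hs le_rfl)

theorem packingDim_le_of_forall_lt {A : Set X} {α : ℝ≥0}
    (h : ∀ s : ℝ≥0, α < s → packingMeasure (s : ℝ) A ≠ ∞) : packingDim A ≤ (α : ℝ≥0∞) :=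
  iSup₂_le fun s hs => by
    by_contra! hlt
    exact h s (by exact_mod_cast hlt) hs

theorem le_packingDim_of_packingMeasure_ne_zero {A : Set X} {α : ℝ≥0}
    (h : packingMeasure (α : ℝ) A ≠ 0) : (α : ℝ≥0∞) ≤ packingDim A := by
  by_contra! hlt
  obtain ⟨s, hs, hsα⟩ := ENNReal.lt_iff_exists_nnreal_btwn.1 hlt
  exact h (packingMeasure_eq_zero_of_lt (by exact_mod_cast hsα)
    (packingMeasure_ne_top_of_packingDim_lt hs))

end PackingLemmas

/-! ### Local dimensions as power bounds on the mass of balls. -/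

section LocalDimensionLemmas

variable {X : Type*} [PseudoMetricSpace X] [MeasurableSpace X]

theorem localDimRatio_le_iff {μ : Measure X} {x : X} {r : ℝ} (h0 : 0 < r) (h1 : r < 1) (t : ℝ) :
    localDimRatio μ x r ≤ (t : EReal) ↔
      ENNReal.ofReal r ^ t ≤ μ (Metric.closedBall x r) := by
  have hlog : Real.log r < 0 := Real.log_neg h0 h1
  have hlog' : ((Real.log r : ℝ) : EReal) < 0 := by exact_mod_cast hlog
  have hpow : ENNReal.log (ENNReal.ofReal r ^ t) = (t : EReal) * ((Real.log r : ℝ) : EReal) := by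
    rw [ENNReal.log_rpow, ENNReal.log_ofReal_of_pos h0]
  have hdiv : ((t : EReal) * ((Real.log r : ℝ) : EReal)) / ((Real.log r : ℝ) : EReal) = t := by
    rw [← EReal.coe_mul, ← EReal.coe_div, mul_div_cancel_right₀ _ hlog.ne]
  rw [← ENNReal.log_le_log_iff, hpow, localDimRatio]
  constructor
  · intro h
    by_contra! hlt
    have := EReal.strictAnti_div_right_of_neg hlog' (EReal.coe_ne_bot _) hlt
    simp only [hdiv] at this
    exact this.not_ge h
  · intro h
    have := EReal.div_le_div_right_of_nonpos hlog'.le h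
    rwa [hdiv] at this

theorem eventually_rpow_le_of_upperLocalDim_lt {μ : Measure X} {x : X} {t : ℝ}
    (h : upperLocalDim μ x < (t : EReal)) :
    ∀ᶠ r in 𝓝[>] (0 : ℝ), ENNReal.ofReal r ^ t ≤ μ (Metric.closedBall x r) := by
  filter_upwards [eventually_lt_of_limsup_lt h, Ioo_mem_nhdsGT (zero_lt_one' ℝ)] with r hr hr'
  exact (localDimRatio_le_iff hr'.1 hr'.2 t).1 hr.le

theorem frequently_rpow_le_of_lowerLocalDim_lt {μ : Measure X} {x : X} {t : ℝ}
    (h : lowerLocalDim μ x < (t : EReal)) :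
    ∃ᶠ r in 𝓝[>] (0 : ℝ), ENNReal.ofReal r ^ t ≤ μ (Metric.closedBall x r) := by
  refine ((frequently_lt_of_liminf_lt (by isBoundedDefault) h).and_eventually
    (Ioo_mem_nhdsGT (zero_lt_one' ℝ))).mono fun r hr => ?_
  exact (localDimRatio_le_iff hr.2.1 hr.2.2 t).1 hr.1.le

theorem lowerLocalDim_le_upperLocalDim (μ : Measure X) (x : X) :
    lowerLocalDim μ x ≤ upperLocalDim μ x :=
  liminf_le_limsup

theorem eventually_rpow_le_mul_rpow {s t : ℝ} (hst : s < t) {c : ℝ≥0∞} (hc : c ≠ 0) :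
    ∀ᶠ r in 𝓝[>] (0 : ℝ), ENNReal.ofReal r ^ t ≤ c * ENNReal.ofReal r ^ s := by
  have hst' : 0 < t - s := sub_pos.2 hst
  filter_upwards [(tendsto_ofReal_rpow_nhdsGT_zero hst').eventually (gt_mem_nhds (pos_iff_ne_zero.2 hc)), self_mem_nhdsWithin]
    with r hr h0
  rw [mem_Ioi] at h0
  calc ENNReal.ofReal r ^ t = ENNReal.ofReal r ^ (t - s) * ENNReal.ofReal r ^ s := by
        rw [← ENNReal.rpow_add _ _ (by simpa using h0) ENNReal.ofReal_ne_top, sub_add_cancel]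
    _ ≤ _ := by gcongr

/-- For any exponent `u > t`, the factor `r ^ (u - t)` tends to `0` and absorbs the constant `c`. -/
theorem upperLocalDim_le_of_eventually_mul_rpow_le {μ : Measure X} {x : X} {t : ℝ} {c : ℝ≥0∞}
    (hc : c ≠ 0)
    (h : ∀ᶠ r in 𝓝[>] (0 : ℝ), c * ENNReal.ofReal r ^ t ≤ μ (Metric.closedBall x r)) :
    upperLocalDim μ x ≤ (t : EReal) := by
  refine EReal.le_of_forall_lt_iff_le.1 fun u hu => ?_
  refine limsup_le_of_le (by isBoundedDefault) ?_
  filter_upwards [h, eventually_rpow_le_mul_rpow (EReal.coe_lt_coe_iff.1 hu) hc,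
    Ioo_mem_nhdsGT (zero_lt_one' ℝ)] with r h1 h2 h3
  exact (localDimRatio_le_iff h3.1 h3.2 u).2 (h2.trans h1)

theorem upperLocalDim_le_of_smul_le {μ ν : Measure X} {a : ℝ≥0∞} (ha : a ≠ 0) (h : a • ν ≤ μ)
    (x : X) : upperLocalDim μ x ≤ upperLocalDim ν x := by
  refine EReal.le_of_forall_lt_iff_le.1 fun u hu => ?_
  refine upperLocalDim_le_of_eventually_mul_rpow_le ha ?_
  filter_upwards [eventually_rpow_le_of_upperLocalDim_lt hu] with r hr
  exact (mul_le_mul_right hr a).trans (h _)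

end LocalDimensionLemmas

/-! ### Merging countably many finite measures. -/

section Combination

variable {X : Type*} [MeasurableSpace X]

theorem exists_finite_measure_dominating {ι : Type*} [Countable ι] (ν : ι → Measure X)
    [∀ i, IsFiniteMeasure (ν i)] :
    ∃ μ : Measure X, IsFiniteMeasure μ ∧
      (∀ s, (∀ i, ν i s = 0) → μ s = 0) ∧ ∀ i, ∃ a : ℝ≥0∞, a ≠ 0 ∧ a • ν i ≤ μ := by
  obtain ⟨ε, hε, hsum⟩ := ENNReal.exists_pos_sum_of_countable' one_ne_zero ι
  -- The `+ 1` covers `ν i = 0`; the total mass is at most `∑ ε i`.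
  let w : ι → ℝ≥0∞ := fun i => ε i / (ν i univ + 1)
  have hw : ∀ i, w i * ν i univ ≤ ε i := fun i => by
    rw [ENNReal.mul_comm_div]
    refine mul_le_of_le_one_right' (ENNReal.div_le_of_le_mul ?_)
    simp
  refine ⟨Measure.sum fun i => w i • ν i, ⟨?_⟩, fun s hs => ?_, fun i => ⟨w i, ?_, ?_⟩⟩
  · rw [Measure.sum_apply _ MeasurableSet.univ]
    exact ((ENNReal.tsum_le_tsum hw).trans_lt hsum).trans ENNReal.one_lt_top
  · rw [Measure.sum_apply_eq_zero]
    intro i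
    simp [hs i]
  · exact ENNReal.div_ne_zero.2 ⟨(hε i).ne', by finiteness⟩
  · exact Measure.le_sum (fun i => w i • ν i) i

end Combination

/-! ### Mass bounds for disjoint balls, and packing measure. -/

section DisjointBalls

variable {X : Type*} [PseudoMetricSpace X] [MeasurableSpace X] [BorelSpace X]

theorem tsum_rpow_radius_le_measure_univ {ι : Type*} {t : ℝ} {μ : Measure X} {u : Set ι}
    (x : ι → X) (r : ι → ℝ)
    (hd : u.PairwiseDisjoint fun i => Metric.closedBall (x i) (r i))
    (h : ∀ i ∈ u, ENNReal.ofReal (r i) ^ t ≤ μ (Metric.closedBall (x i) (r i))) :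
    ∑' i : u, ENNReal.ofReal (r i) ^ t ≤ μ univ :=
  (ENNReal.tsum_le_tsum fun i : u => h i i.2).trans <|
    (tsum_meas_le_meas_iUnion_of_disjoint μ (fun _ => Metric.isClosed_closedBall.measurableSet)
      ((pairwise_subtype_iff_pairwise_set _ _).2 hd)).trans (measure_mono (subset_univ _))

/-- The set where the upper local dimension is less than `t` is null for `𝒫 ^ s`, `t < s`. -/
theorem packingMeasure_upperLocalDim_lt_eq_zero (μ : Measure X) [IsFiniteMeasure μ] {s t : ℝ}
    (ht : 0 ≤ t) (hts : t < s) :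
    packingMeasure s {x | upperLocalDim μ x < (t : EReal)} = 0 := by
  -- The scale below which the mass bound holds depends on the point; on `A n` it is uniform, so
  -- every sufficiently fine packing of `A n` obeys the bound.
  let A : ℕ → Set X := fun n => {x | ∀ r ∈ Ioc (0 : ℝ) (1 / (n + 1)),
    ENNReal.ofReal r ^ t ≤ μ (Metric.closedBall x r)}
  have hsub : {x | upperLocalDim μ x < (t : EReal)} ⊆ ⋃ n, A n := by
    intro x hx
    obtain ⟨ε, hε, h⟩ := mem_nhdsGT_iff_exists_Ioc_subset.1
      (eventually_rpow_le_of_upperLocalDim_lt hx)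
    obtain ⟨n, hn⟩ := exists_nat_one_div_lt (show (0 : ℝ) < ε from hε)
    exact mem_iUnion.2 ⟨n, fun r hr => h ⟨hr.1, hr.2.trans hn.le⟩⟩
  refine le_antisymm ((packingMeasure_mono s hsub).trans
    (packingMeasure_iUnion_null fun n => ?_).le) zero_le
  refine le_antisymm ((packingMeasure_le_packingPremeasure _ _).trans
    (packingPremeasure_eq_zero_of_lt hts ?_).le) zero_le
  refine ne_top_of_le_ne_top (b := 2 ^ t * μ univ) (by finiteness) ?_
  refine iInf₂_le_of_le (1 / (n + 1)) (by positivity) (iSup₂_le fun P hP => ?_)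
  have : ∀ p : P, ENNReal.ofReal (2 * p.1.2) ^ t = 2 ^ t * ENNReal.ofReal p.1.2 ^ t := fun p => by
    rw [ENNReal.ofReal_mul zero_le_two, ENNReal.mul_rpow_of_nonneg _ _ ht]
    simp
  simp only [this, ENNReal.tsum_mul_left]
  gcongr
  refine tsum_rpow_radius_le_measure_univ (fun p : X × ℝ => p.1) (fun p => p.2) hP.2.2
    fun p hp => (hP.2.1 p hp).1 _ ⟨(hP.2.1 p hp).2.1, ?_⟩
  linarith [(hP.2.1 p hp).2]

end DisjointBalls

/-! ### Vitali coverings and Hausdorff measure. -/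

section Hausdorff

variable {X : Type*} [MetricSpace X] [MeasurableSpace X] [BorelSpace X]
  [TopologicalSpace.SeparableSpace X]

/-- A small lower local dimension gives heavy balls only at some arbitrarily small radii, which is
enough for a covering: Vitali selects disjoint heavy balls whose 5-fold enlargements, of diameter at
most `10 * r`, cover the set. -/
theorem hausdorffMeasure_lowerLocalDim_lt_ne_top (μ : Measure X) [IsFiniteMeasure μ] {t : ℝ}
    (ht : 0 ≤ t) :
    Measure.hausdorffMeasure t {x | lowerLocalDim μ x < (t : EReal)} ≠ ∞ := by
  set A := {x | lowerLocalDim μ x < (t : EReal)}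
  have hex : ∀ n : ℕ, ∀ x, x ∈ A → ∃ r ∈ Ioc (0 : ℝ) (1 / (n + 1)),
      ENNReal.ofReal r ^ t ≤ μ (Metric.closedBall x r) := fun n x hx => by
    obtain ⟨r, h, hr⟩ := ((frequently_rpow_le_of_lowerLocalDim_lt hx).and_eventually
      (Ioc_mem_nhdsGT (Nat.one_div_pos_of_nat (α := ℝ) (n := n)))).exists
    exact ⟨r, hr, h⟩
  choose! r hr hrμ using hex
  choose u huA hud hucov using fun n : ℕ =>
    Vitali.exists_disjoint_subfamily_covering_enlargement_closedBall A id (r n) (1 / (n + 1))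
      (fun x hx => (hr n x hx).2) 5 (by norm_num)
  have hcount : ∀ n, Countable (u n) := fun n =>
    ((hud n).countable_of_nonempty_interior fun x hx => ⟨x, Metric.ball_subset_interior_closedBall
      (Metric.mem_ball_self (hr n x (huA n hx)).1)⟩).to_subtype
  have hdiam : ∀ n (x : u n), Metric.ediam (Metric.closedBall (x : X) (5 * r n x)) ≤
      10 * ENNReal.ofReal (r n x) := fun n x => by
    have h0 := (hr n x (huA n x.2)).1.le
    rw [← Metric.closedEBall_ofReal (by positivity)]
    refine Metric.ediam_closedEBall_le.trans ?_
    rw [ENNReal.ofReal_mul (by norm_num), ← mul_assoc]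
    norm_num
  have hlim : Tendsto (fun n : ℕ => 10 * ENNReal.ofReal (1 / ((n : ℝ) + 1))) atTop (𝓝 0) := by
    have := (ENNReal.continuous_ofReal.tendsto 0).comp
      (tendsto_one_div_add_atTop_nhds_zero_nat (𝕜 := ℝ))
    simpa using ENNReal.Tendsto.const_mul (a := 10) this (Or.inr (by simp))
  have key := Measure.hausdorffMeasure_le_liminf_tsum t A _ hlim
    (fun n (x : u n) => Metric.closedBall (x : X) (5 * r n x))
    (Eventually.of_forall fun n x => (hdiam n x).trans (by
      gcongr
      exact (hr n x (huA n x.2)).2))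
    (Eventually.of_forall fun n x hx => by
      obtain ⟨b, hb, hsub⟩ := hucov n x hx
      exact mem_iUnion.2 ⟨⟨b, hb⟩, hsub (Metric.mem_closedBall_self (hr n x hx).1.le)⟩)
  refine ne_top_of_le_ne_top (b := 10 ^ t * μ univ) (by finiteness) (key.trans ?_)
  refine liminf_le_of_le (by isBoundedDefault) fun b hb => ?_
  obtain ⟨n, hn⟩ := hb.exists
  refine hn.trans ?_
  calc ∑' x : u n, Metric.ediam (Metric.closedBall (x : X) (5 * r n x)) ^ t
      ≤ ∑' x : u n, 10 ^ t * ENNReal.ofReal (r n x) ^ t := by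
        refine ENNReal.tsum_le_tsum fun x => ?_
        rw [← ENNReal.mul_rpow_of_nonneg _ _ ht]
        exact ENNReal.rpow_le_rpow (hdiam n x) ht
    _ ≤ 10 ^ t * μ univ := by
        rw [ENNReal.tsum_mul_left]
        gcongr
        exact tsum_rpow_radius_le_measure_univ id (r n) (hud n) fun x hx => hrμ n x (huA n hx)

theorem hausdorffMeasure_lowerLocalDim_lt_eq_zero (μ : Measure X) [IsFiniteMeasure μ] {s t : ℝ}
    (ht : 0 ≤ t) (hts : t < s) :
    Measure.hausdorffMeasure s {x | lowerLocalDim μ x < (t : EReal)} = 0 :=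
  (Measure.hausdorffMeasure_zero_or_top hts _).resolve_right
    (hausdorffMeasure_lowerLocalDim_lt_ne_top μ ht)

end Hausdorff

/-! ### Measures with prescribed upper bounds on local dimension. -/

section Construction

variable {X : Type*} [MetricSpace X] [TopologicalSpace.SeparableSpace X]

/-- A Vitali subfamily of the balls of radius `r` is a packing, which bounds the size of the net. -/
theorem exists_net_of_packingPremeasureAt {s δ r : ℝ} (hr : 0 < r) (hrδ : 2 * r ≤ δ) (A : Set X) :
    ∃ u ⊆ A, u.Countable ∧ ∑' _ : u, ENNReal.ofReal (2 * r) ^ s ≤ packingPremeasureAt s δ A ∧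
      ∀ x ∈ A, ∃ c ∈ u, dist c x ≤ 5 * r := by
  obtain ⟨u, huA, hud, hucov⟩ :=
    Vitali.exists_disjoint_subfamily_covering_enlargement_closedBall A id (fun _ => r) r
      (fun _ _ => le_rfl) 5 (by norm_num)
  have hcount : u.Countable := hud.countable_of_nonempty_interior fun x _ =>
    ⟨x, Metric.ball_subset_interior_closedBall (Metric.mem_ball_self hr)⟩
  refine ⟨u, huA, hcount, ?_, fun x hx => ?_⟩
  · have hinj : Function.Injective fun x : X => (x, r) := fun x y h => (Prod.mk.inj h).1
    have hP : IsPacking δ A ((fun x : X => (x, r)) '' u) := by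
      refine ⟨hcount.image _, ?_, ?_⟩
      · rintro _ ⟨x, hx, rfl⟩
        exact ⟨huA hx, hr, hrδ⟩
      · rw [hinj.injOn.pairwiseDisjoint_image]
        exact hud
    refine le_trans (le_of_eq ?_) (le_iSup₂_of_le _ hP le_rfl)
    exact ((Equiv.Set.image _ u hinj).tsum_eq
      (fun p : ((fun x : X => (x, r)) '' u) => ENNReal.ofReal (2 * p.1.2) ^ s))
  · obtain ⟨c, hc, hsub⟩ := hucov x hx
    refine ⟨c, hc, ?_⟩
    rw [dist_comm]
    exact hsub (Metric.mem_closedBall_self hr.le)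

variable [MeasurableSpace X] [BorelSpace X]

theorem exists_measure_upperLocalDim_le_of_packingPremeasure {s t : ℝ} (hs : 0 ≤ s) (hst : s < t)
    {A : Set X} (hA : packingPremeasure s A ≠ ∞) :
    ∃ ν : Measure X, IsFiniteMeasure ν ∧ ν Aᶜ = 0 ∧ ∀ x ∈ A, upperLocalDim ν x ≤ (t : EReal) := by
  obtain ⟨δ, hδ, hM⟩ := exists_packingPremeasureAt_lt_top hA
  set M := packingPremeasureAt s δ A
  have ht : 0 ≤ t := hs.trans hst.le
  let r : ℕ → ℝ := fun n => δ / 2 * (1 / 2) ^ n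
  have hr : ∀ n, 0 < r n := fun n => by positivity
  have hrδ : ∀ n, 2 * r n ≤ δ := fun n => by
    have : ((1 : ℝ) / 2) ^ n ≤ 1 := pow_le_one₀ (by norm_num) (by norm_num)
    simp only [r]
    nlinarith
  choose u huA hcount hsum hcov using fun n =>
    exists_net_of_packingPremeasureAt (s := s) (hr n) (hrδ n) A
  -- There are at most about `M * r n ^ (-s)` net points at level `n`, so that level has mass at
  -- most `M * r n ^ (t - s)`, which is summable.
  let ν : Measure X := Measure.sum fun n =>
    ENNReal.ofReal (r n) ^ t • Measure.sum fun c : u n => Measure.dirac (c : X)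
  have hfin : ν univ < ∞ := by
    have hmass : ∀ n, (ENNReal.ofReal (r n) ^ t • Measure.sum fun c : u n =>
        Measure.dirac (c : X)) univ ≤
        ENNReal.ofReal (δ / 2) ^ (t - s) * M * (ENNReal.ofReal (1 / 2) ^ (t - s)) ^ n := by
      intro n
      rw [Measure.smul_apply, Measure.sum_apply _ MeasurableSet.univ, smul_eq_mul]
      have hcard : ENNReal.ofReal (r n) ^ s * ∑' c : u n, Measure.dirac (c : X) univ ≤ M := by
        rw [← ENNReal.tsum_mul_left]
        refine (ENNReal.tsum_le_tsum fun c => ?_).trans (hsum n)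
        rw [measure_univ, mul_one]
        gcongr
        linarith [hr n]
      have hsplit : ENNReal.ofReal (r n) ^ t =
          ENNReal.ofReal (r n) ^ (t - s) * ENNReal.ofReal (r n) ^ s := by
        rw [← ENNReal.rpow_add _ _ (by simpa using hr n) ENNReal.ofReal_ne_top, sub_add_cancel]
      have hpow : ENNReal.ofReal (r n) ^ (t - s) =
          ENNReal.ofReal (δ / 2) ^ (t - s) * (ENNReal.ofReal (1 / 2) ^ (t - s)) ^ n := by
        simp only [r]
        rw [ENNReal.ofReal_mul (by positivity), ENNReal.mul_rpow_of_nonneg _ _ (by linarith),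
          ENNReal.ofReal_pow (by norm_num), ← ENNReal.rpow_natCast, ← ENNReal.rpow_natCast,
          ← ENNReal.rpow_mul, ← ENNReal.rpow_mul, mul_comm (n : ℝ)]
      rw [hsplit, mul_assoc, hpow, mul_assoc, mul_assoc, mul_comm M]
      gcongr
    rw [Measure.sum_apply _ MeasurableSet.univ]
    refine (ENNReal.tsum_le_tsum hmass).trans_lt ?_
    rw [ENNReal.tsum_mul_left, ENNReal.tsum_geometric]
    refine ENNReal.mul_lt_top (ENNReal.mul_lt_top ?_ hM) ?_
    · exact ENNReal.rpow_lt_top_of_nonneg (by linarith) ENNReal.ofReal_ne_top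
    · rw [ENNReal.inv_lt_top, tsub_pos_iff_lt]
      refine ENNReal.rpow_lt_one ?_ (by linarith)
      rw [ENNReal.ofReal_lt_one]
      norm_num
  refine ⟨ν, ⟨hfin⟩, ?_, fun x hx => ?_⟩
  · simp only [ν, Measure.sum_apply_eq_zero, Measure.smul_apply, smul_eq_mul, mul_eq_zero]
    intro n
    right
    have := (hcount n).to_subtype
    rw [Measure.sum_apply_eq_zero]
    intro c
    simpa [Measure.dirac_apply] using huA n c.2
  · refine upperLocalDim_le_of_eventually_mul_rpow_le (c := ENNReal.ofReal (1 / 10) ^ t)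
      (by simp [ENNReal.rpow_eq_zero_iff]) ?_
    filter_upwards [Ioo_mem_nhdsGT (show (0 : ℝ) < 5 * (δ / 2) by positivity)] with ρ hρ
    -- Choose `n` with `5 * r (n + 1) < ρ ≤ 5 * r n = 10 * r (n + 1)`: the ball then contains a net
    -- point of level `n + 1`, and the constant `1 / 10` appears.
    obtain ⟨n, hn1, hn2⟩ := exists_nat_pow_near_of_lt_one
      (show 0 < ρ / (5 * (δ / 2)) by have := hρ.1; positivity)
      ((div_le_one (by positivity)).2 hρ.2.le) (show (0 : ℝ) < 1 / 2 by norm_num) (by norm_num)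
    rw [lt_div_iff₀ (by positivity)] at hn1
    rw [div_le_iff₀ (by positivity)] at hn2
    obtain ⟨c, hc, hcx⟩ := hcov (n + 1) x hx
    have hle : 1 / 10 * ρ ≤ r (n + 1) := by
      simp only [r, pow_succ]
      nlinarith
    have hmem : c ∈ Metric.closedBall x ρ := by
      refine Metric.mem_closedBall.2 (hcx.trans ?_)
      simp only [r]
      linarith
    calc ENNReal.ofReal (1 / 10) ^ t * ENNReal.ofReal ρ ^ t
        = ENNReal.ofReal (1 / 10 * ρ) ^ t := by
          rw [ENNReal.ofReal_mul (by norm_num), ENNReal.mul_rpow_of_nonneg _ _ ht]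
      _ ≤ ENNReal.ofReal (r (n + 1)) ^ t := by gcongr
      _ = ENNReal.ofReal (r (n + 1)) ^ t * Measure.dirac c (Metric.closedBall x ρ) := by
          rw [Measure.dirac_apply_of_mem hmem, mul_one]
      _ ≤ ENNReal.ofReal (r (n + 1)) ^ t *
            (Measure.sum fun c : u (n + 1) => Measure.dirac (c : X)) (Metric.closedBall x ρ) := by
          gcongr
          exact Measure.le_sum (fun c : u (n + 1) => Measure.dirac (c : X)) ⟨c, hc⟩
      _ ≤ ν (Metric.closedBall x ρ) := Measure.le_sum (fun n => ENNReal.ofReal (r n) ^ t •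
          Measure.sum fun c : u n => Measure.dirac (c : X)) (n + 1) _

theorem exists_measure_upperLocalDim_le_of_packingMeasure {s t : ℝ} (hs : 0 ≤ s) (hst : s < t)
    {A : Set X} (hA : packingMeasure s A ≠ ∞) :
    ∃ ν : Measure X, IsFiniteMeasure ν ∧ ν Aᶜ = 0 ∧ ∀ x ∈ A, upperLocalDim ν x ≤ (t : EReal) := by
  obtain ⟨F, hF, hF'⟩ := exists_cover_packingPremeasure_ne_top hA
  -- The cover may leave `A`; intersecting keeps the measures carried by `A`.
  have hFA : ∀ i, packingPremeasure s (F i ∩ A) ≠ ∞ := fun i =>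
    ne_top_of_le_ne_top (hF' i) (iInf₂_mono fun δ _ => packingPremeasureAt_mono inter_subset_left)
  choose ν hν hνA hνx using fun i =>
    exists_measure_upperLocalDim_le_of_packingPremeasure hs hst (hFA i)
  obtain ⟨μ, hμ, hμ0, hμν⟩ := exists_finite_measure_dominating ν
  refine ⟨μ, hμ, hμ0 _ fun i => measure_mono_null (compl_subset_compl.2 inter_subset_right)
    (hνA i), fun x hx => ?_⟩
  obtain ⟨i, hi⟩ := mem_iUnion.1 (hF hx)
  obtain ⟨a, ha, hle⟩ := hμν i
  exact (upperLocalDim_le_of_smul_le ha hle x).trans (hνx i x ⟨hi, hx⟩)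

theorem exists_measure_upperLocalDim_le_of_packingDim_lt {A : Set X} {t : ℝ≥0}
    (h : packingDim A < (t : ℝ≥0∞)) :
    ∃ ν : Measure X, IsFiniteMeasure ν ∧ ν Aᶜ = 0 ∧
      ∀ x ∈ A, upperLocalDim ν x ≤ ((t : ℝ) : EReal) := by
  obtain ⟨s, hs, hst⟩ := ENNReal.lt_iff_exists_nnreal_btwn.1 h
  exact exists_measure_upperLocalDim_le_of_packingMeasure s.2 (by exact_mod_cast hst)
    (packingMeasure_ne_top_of_packingDim_lt hs)

/-- A countable family of sets carries one probability measure whose upper local dimension is, on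
each set of the family, at most its packing dimension. -/
theorem exists_probMeasure_upperLocalDim_le {ι : Type*} [Countable ι] {K : Set X}
    (hne : K.Nonempty) (A : ι → Set X) (hA : ∀ i, A i ⊆ K) :
    ∃ μ ∈ probMeasuresOn K, ∀ i, ∀ t : ℝ≥0, packingDim (A i) < (t : ℝ≥0∞) →
      ∀ x ∈ A i, upperLocalDim μ x ≤ ((t : ℝ) : EReal) := by
  let D := TopologicalSpace.denseSeq ℝ≥0
  have hex : ∀ p : ι × ℕ, ∃ ν : Measure X, IsFiniteMeasure ν ∧ ν Kᶜ = 0 ∧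
      (packingDim (A p.1) < (D p.2 : ℝ≥0∞) →
        ∀ x ∈ A p.1, upperLocalDim ν x ≤ ((D p.2 : ℝ) : EReal)) := by
    intro p
    by_cases h : packingDim (A p.1) < (D p.2 : ℝ≥0∞)
    · obtain ⟨ν, hν, hν0, hνx⟩ := exists_measure_upperLocalDim_le_of_packingDim_lt h
      exact ⟨ν, hν, measure_mono_null (compl_subset_compl.2 (hA _)) hν0, fun _ => hνx⟩
    · exact ⟨0, inferInstance, by simp, fun h' => absurd h' h⟩
  choose ν hν hνK hνx using hex
  obtain ⟨μ₀, hμ₀, hμ₀K, hle⟩ := exists_finite_measure_dominating ν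
  obtain ⟨x₀, hx₀⟩ := hne
  -- The point mass makes the measure nonzero, so it can be normalised.
  let μ₁ := μ₀ + Measure.dirac x₀
  have hne : NeZero μ₁ := ⟨fun h => by
    have := congrArg (fun m : Measure X => m univ) h
    simp [μ₁] at this⟩
  refine ⟨(μ₁ univ)⁻¹ • μ₁, ⟨inferInstance, ?_⟩, fun i t ht x hx => ?_⟩
  · simp [μ₁, hμ₀K _ hνK, Measure.dirac_apply, hx₀]
  · obtain ⟨t', ht', htt'⟩ := ENNReal.lt_iff_exists_nnreal_btwn.1 ht
    obtain ⟨_, ⟨n, rfl⟩, hn, hn'⟩ := (TopologicalSpace.denseRange_denseSeq ℝ≥0).exists_between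
      (ENNReal.coe_lt_coe.1 htt')
    obtain ⟨a, ha, hle⟩ := hle (i, n)
    have hc : (μ₁ univ)⁻¹ ≠ 0 := by simp
    have hle' : ((μ₁ univ)⁻¹ * a) • ν (i, n) ≤ (μ₁ univ)⁻¹ • μ₁ := by
      rw [mul_smul]
      gcongr
      exact hle.trans (Measure.le_add_right le_rfl)
    refine (upperLocalDim_le_of_smul_le (mul_ne_zero hc ha) hle' x).trans
      ((hνx (i, n) (ht'.trans (by exact_mod_cast hn)) x hx).trans ?_)
    exact_mod_cast hn'.le

/-- A dimension family of subsets of `K` carries a probability measure whose upper local dimension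
is at most `α` on `E α`. -/
theorem IsDimensionFamily.exists_probMeasure {K : Set X} {E : ℝ≥0 → Set X}
    (hE : IsDimensionFamily K E) (hne : K.Nonempty) :
    ∃ μ ∈ probMeasuresOn K, ∀ α : ℝ≥0, 0 < α → (α : ℝ≥0∞) < packingDim K →
      ∀ x ∈ E α, upperLocalDim μ x ≤ ((α : ℝ) : EReal) := by
  let D := TopologicalSpace.denseSeq ℝ≥0
  obtain ⟨μ, hμ, h⟩ := exists_probMeasure_upperLocalDim_le hne
    (fun n : {n : ℕ // 0 < D n ∧ (D n : ℝ≥0∞) < packingDim K} => E (D n))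
    (fun n => (hE.1 _ n.2.1 n.2.2).2.1)
  refine ⟨μ, hμ, fun α hα hαK x hx => EReal.le_of_forall_lt_iff_le.1 fun u hu => ?_⟩
  have hu' : (α : ℝ) < u := EReal.coe_lt_coe_iff.1 hu
  lift u to ℝ≥0 using α.2.trans hu'.le
  obtain ⟨q, hq, hqlt⟩ := ENNReal.lt_iff_exists_nnreal_btwn.1
    (lt_min hαK (ENNReal.coe_lt_coe.2 (NNReal.coe_lt_coe.1 hu')))
  obtain ⟨_, ⟨n, rfl⟩, hn, hn'⟩ := (TopologicalSpace.denseRange_denseSeq ℝ≥0).exists_between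
    (ENNReal.coe_lt_coe.1 hq)
  have hnlt := (ENNReal.coe_lt_coe.2 hn').trans hqlt
  have h0 : 0 < D n := hα.trans hn
  have hK := hnlt.trans_le (min_le_left _ _)
  refine h ⟨n, h0, hK⟩ u ?_ x (hE.2 α (D n) hα hn.le hK hx)
  rw [(hE.1 _ h0 hK).2.2]
  exact hnlt.trans_le (min_le_right _ _)

end Construction

/-! ### Dimensions of the level sets. -/

section LevelSets

theorem OuterMeasure.setOf_lt_null {X : Type*} (m : OuterMeasure X) (f : X → EReal) {α : ℝ}
    (hα : 0 < α) (h : ∀ t : ℝ, 0 ≤ t → t < α → m {x | f x < (t : EReal)} = 0) :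
    m {x | f x < (α : EReal)} = 0 := by
  have hsub : {x | f x < (α : EReal)} ⊆
      ⋃ q : {q : ℚ // 0 ≤ (q : ℝ) ∧ (q : ℝ) < α}, {x | f x < ((q : ℝ) : EReal)} := by
    intro x hx
    obtain ⟨q, hq, hqα⟩ := EReal.lt_iff_exists_rat_btwn.1 hx
    have hqα' : (q : ℝ) < α := by exact_mod_cast hqα
    -- The rational `q` may be negative, while `h` needs a nonnegative threshold.
    refine mem_iUnion.2 ⟨⟨max q 0, by simp, by simp [hqα', hα]⟩, hq.trans_le ?_⟩
    exact EReal.coe_le_coe_iff.2 (by simp)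
  exact measure_mono_null hsub (measure_iUnion_null fun q => h q q.2.1 q.2.2)

variable {X : Type*} [MetricSpace X] [MeasurableSpace X] [BorelSpace X]

theorem packingMeasure_upperLocalDim_lt_eq_zero' (μ : Measure X) [IsFiniteMeasure μ] {α : ℝ}
    (hα : 0 < α) : packingMeasure α {x | upperLocalDim μ x < (α : EReal)} = 0 := by
  rw [← packingOuterMeasure_apply]
  refine OuterMeasure.setOf_lt_null _ _ hα fun t ht htα => ?_
  rw [packingOuterMeasure_apply]
  exact packingMeasure_upperLocalDim_lt_eq_zero μ ht htα

theorem packingDim_le_of_upperLocalDim_le (μ : Measure X) [IsFiniteMeasure μ] {α : ℝ≥0}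
    {A : Set X} (hA : ∀ x ∈ A, upperLocalDim μ x ≤ ((α : ℝ) : EReal)) :
    packingDim A ≤ (α : ℝ≥0∞) := by
  refine packingDim_le_of_forall_lt fun s hs => ?_
  have hpos : (0 : ℝ) < s := α.2.trans_lt hs
  refine ne_top_of_le_ne_top (b := 0) (by simp) ?_
  rw [← packingMeasure_upperLocalDim_lt_eq_zero' μ hpos]
  exact packingMeasure_mono _ fun x hx => (hA x hx).trans_lt (by exact_mod_cast hs)

theorem packingDim_upperLevelSet (μ : Measure X) [IsFiniteMeasure μ] {K E : Set X} {α : ℝ≥0}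
    (hα : 0 < α) (hEK : E ⊆ K) (hE : ∀ x ∈ E, upperLocalDim μ x ≤ ((α : ℝ) : EReal))
    (hpos : 0 < packingMeasure (α : ℝ) E) :
    packingDim (upperLevelSet K μ (α : ℝ)) = (α : ℝ≥0∞) := by
  refine le_antisymm (packingDim_le_of_upperLocalDim_le μ fun x hx => hx.2.le)
    (le_packingDim_of_packingMeasure_ne_zero (packingMeasure_ne_zero_of_diff_null hpos.ne' ?_))
  refine le_antisymm ?_ zero_le
  rw [← packingMeasure_upperLocalDim_lt_eq_zero' μ (NNReal.coe_pos.2 hα)]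
  exact packingMeasure_mono _ fun x hx =>
    (hE x hx.1).lt_of_ne fun h => hx.2 ⟨hEK hx.1, h⟩

variable [TopologicalSpace.SeparableSpace X]

theorem hausdorffMeasure_lowerLocalDim_lt_eq_zero' (μ : Measure X) [IsFiniteMeasure μ] {α : ℝ}
    (hα : 0 < α) :
    Measure.hausdorffMeasure α {x | lowerLocalDim μ x < (α : EReal)} = 0 :=
  OuterMeasure.setOf_lt_null (Measure.hausdorffMeasure α).toOuterMeasure _ hα
    fun _ ht htα => hausdorffMeasure_lowerLocalDim_lt_eq_zero μ ht htα

theorem dimH_le_of_lowerLocalDim_le (μ : Measure X) [IsFiniteMeasure μ] {α : ℝ≥0}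
    {A : Set X} (hA : ∀ x ∈ A, lowerLocalDim μ x ≤ ((α : ℝ) : EReal)) :
    dimH A ≤ (α : ℝ≥0∞) := by
  refine le_of_forall_gt_imp_ge_of_dense fun b hb => ?_
  obtain ⟨s, hs, hsb⟩ := ENNReal.lt_iff_exists_nnreal_btwn.1 hb
  refine (dimH_le_of_hausdorffMeasure_ne_top (ne_top_of_le_ne_top
    (hausdorffMeasure_lowerLocalDim_lt_ne_top μ s.2) (measure_mono fun x hx => ?_))).trans hsb.le
  exact (hA x hx).trans_lt (by exact_mod_cast hs)

/-- For `s > packingDim A`, the net measure has upper, hence lower, local dimension at most `s` on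
`A`, and the Vitali bound applies. -/
theorem dimH_le_packingDim (A : Set X) : dimH A ≤ packingDim A := by
  refine le_of_forall_gt_imp_ge_of_dense fun b hb => ?_
  obtain ⟨s, hs, hsb⟩ := ENNReal.lt_iff_exists_nnreal_btwn.1 hb
  obtain ⟨ν, hν, -, h⟩ := exists_measure_upperLocalDim_le_of_packingDim_lt hs
  exact (dimH_le_of_lowerLocalDim_le ν fun x hx =>
    (lowerLocalDim_le_upperLocalDim ν x).trans (h x hx)).trans hsb.le

theorem dimH_levelSet (μ : Measure X) [IsFiniteMeasure μ] {K E : Set X} {α : ℝ≥0}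
    (hα : 0 < α) (hEK : E ⊆ K) (hE : ∀ x ∈ E, upperLocalDim μ x ≤ ((α : ℝ) : EReal))
    (hpos : 0 < Measure.hausdorffMeasure (α : ℝ) E) :
    dimH (levelSet K μ (α : ℝ)) = (α : ℝ≥0∞) := by
  refine le_antisymm (dimH_le_of_lowerLocalDim_le μ fun x hx => hx.2.1.le)
    (le_dimH_of_hausdorffMeasure_ne_zero fun h => hpos.ne' ?_)
  refine measure_mono_null (t := levelSet K μ (α : ℝ) ∪ {x | lowerLocalDim μ x < ((α : ℝ) : EReal)})
    (fun x hx => ?_) (measure_union_null h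
      (hausdorffMeasure_lowerLocalDim_lt_eq_zero' μ (NNReal.coe_pos.2 hα)))
  by_cases hlt : lowerLocalDim μ x < ((α : ℝ) : EReal)
  · exact Or.inr hlt
  · have hle := lowerLocalDim_le_upperLocalDim μ x
    exact Or.inl ⟨hEK hx, le_antisymm (hle.trans (hE x hx)) (not_lt.1 hlt),
      le_antisymm (hE x hx) ((not_lt.1 hlt).trans hle)⟩

theorem packingDim_levelSet (μ : Measure X) [IsFiniteMeasure μ] {K E : Set X} {α : ℝ≥0}
    (hα : 0 < α) (hEK : E ⊆ K) (hE : ∀ x ∈ E, upperLocalDim μ x ≤ ((α : ℝ) : EReal))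
    (hpos : 0 < Measure.hausdorffMeasure (α : ℝ) E) :
    packingDim (levelSet K μ (α : ℝ)) = (α : ℝ≥0∞) :=
  le_antisymm (packingDim_le_of_upperLocalDim_le μ fun _ hx => hx.2.2.le)
    ((dimH_levelSet μ hα hEK hE hpos).ge.trans (dimH_le_packingDim _))

end LevelSets

theorem theorem3 (d : ℕ) (K : Set (EuclideanSpace ℝ (Fin d))) (hK : IsCompact K)
    (hne : K.Nonempty) :
    ((∃ E : ℝ≥0 → Set (EuclideanSpace ℝ (Fin d)), IsDimensionFamily K E ∧
        ∀ α : ℝ≥0, 0 < α → (α : ℝ≥0∞) < packingDim K → 0 < packingMeasure (α : ℝ) (E α)) →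
      ∃ μ ∈ probMeasuresOn K, ∀ α : ℝ≥0, 0 < α → (α : ℝ≥0∞) < packingDim K →
        packingDim (upperLevelSet K μ (α : ℝ)) = (α : ℝ≥0∞)) ∧
    ((∃ E : ℝ≥0 → Set (EuclideanSpace ℝ (Fin d)), IsDimensionFamily K E ∧
        ∀ α : ℝ≥0, 0 < α → (α : ℝ≥0∞) < packingDim K →
          0 < Measure.hausdorffMeasure (α : ℝ) (E α)) →
      ∃ μ ∈ probMeasuresOn K, ∀ α : ℝ≥0, 0 < α → (α : ℝ≥0∞) < packingDim K →
        dimH (levelSet K μ (α : ℝ)) = (α : ℝ≥0∞) ∧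
        packingDim (levelSet K μ (α : ℝ)) = (α : ℝ≥0∞)) := by
  constructor
  · rintro ⟨E, hE, hpos⟩
    obtain ⟨μ, hμ, hle⟩ := hE.exists_probMeasure hne
    have := hμ.1
    exact ⟨μ, hμ, fun α hα hαK => packingDim_upperLevelSet μ hα (hE.1 α hα hαK).2.1
      (hle α hα hαK) (hpos α hα hαK)⟩
  · rintro ⟨E, hE, hpos⟩
    obtain ⟨μ, hμ, hle⟩ := hE.exists_probMeasure hne
    have := hμ.1
    exact ⟨μ, hμ, fun α hα hαK =>
      ⟨dimH_levelSet μ hα (hE.1 α hα hαK).2.1 (hle α hα hαK) (hpos α hα hαK),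
        packingDim_levelSet μ hα (hE.1 α hα hαK).2.1 (hle α hα hαK) (hpos α hα hαK)⟩⟩
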